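/- All graphs are finite, simple and undirected. A proper edge coloring of a graph $G$ is an assignment of colors to the edges of $G$ such that distinct edges sharing an endpoint receive different colors; it is acyclic if no cycle of $G$ has its edges colored with exactly two colors. The acyclic chromatic index $a'(G)$ is the minimum number of colors in an acyclic edge coloring of $G$. A graph is $3$-sparse if every edge is incident on at least one vertex of degree at most $3$. If $G$ is a $3$-sparse graph with maximum degree $\Delta$, then $a'(G) \le \Delta + 2$. -/

import Mathlib

namespace SimpleGraph

variable {V : Type*}

/-- `G` is `k`-sparse: every edge is incident on at least one vertex of degree at most `k`. -/
def IsSparse (G : SimpleGraph V) [G.LocallyFinite] (k : ℕ) : Prop :=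
  ∀ ⦃x y : V⦄, G.Adj x y → G.degree x ≤ k ∨ G.degree y ≤ k

/-- The cycle `w` is bichromatic for the edge coloring `c`: its edges receive exactly two
colors. -/
def IsBichromatic {G : SimpleGraph V} {α : Type*} (c : G.edgeSet → α) {v : V}
    (w : G.Walk v v) : Prop :=
  {a : α | ∃ e : G.edgeSet, (e : Sym2 V) ∈ w.edges ∧ c e = a}.ncard = 2

/-- A proper edge coloring (a proper vertex coloring of the line graph, so that distinct edges
sharing an endpoint get distinct colors) is acyclic if there is no bichromatic cycle. -/
def IsAcyclicEdgeColoring {G : SimpleGraph V} {α : Type*} (c : G.lineGraph.Coloring α) : Prop :=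
  ∀ (v : V) (w : G.Walk v v), w.IsCycle → ¬ IsBichromatic c w

/-- `G` has an acyclic edge coloring with (at most) `k` colors. -/
def AcyclicEdgeColorable (G : SimpleGraph V) (k : ℕ) : Prop :=
  ∃ c : G.lineGraph.Coloring (Fin k), IsAcyclicEdgeColoring c

/-- The acyclic chromatic index `a'(G)`: the least number of colors of an acyclic edge coloring
of `G`, with value `⊤` if finitely many colors never suffice. -/
noncomputable def acyclicChromaticIndex (G : SimpleGraph V) : ℕ∞ :=
  ⨅ k ∈ {k : ℕ | G.AcyclicEdgeColorable k}, (k : ℕ∞)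

end SimpleGraph

/-! Induct on the edge set: delete all edges at a vertex `u` of degree at most three, color the rest
with `D + 2` colors, and put the star at `u` back. A neighbor of `u` keeps degree at most `D - 1`,
so it misses at least three colors. New edges with distinct missing colors create a bichromatic
cycle only through a conflict: a path in the two chosen colors joining two neighbors of `u`. Such
paths are rigid. Two-colored components have maximum degree two, so they contain at most two
vertices missing one of the two colors (`IsAcyclicPartial.not_reachable`).

If every neighbor of `u` has degree at least four, sparsity makes them hubs, whose own neighbors
have degree at most three. If a color `b` missing at `z` conflicts with each color of `T` missing at
a hub `y`, then all these paths leave `y` by its `b`-edge and continue in the colors of `T`. The far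
end sees `b` and all of `T`, so `T` has at most two colors; if it has two, the far end is known
exactly (`IsAcyclicPartial.exists_neighbor`), and the `b`-edge can be recolored safely
(`IsAcyclicPartial.recolor`). Such recolorings make any color missing at two or three hubs usable
(`false_of_common_three`, `false_of_common_two`); otherwise conflicts are few enough for a greedy
choice.

If `u` has degree three and a neighbor `v` of degree at most three, start instead from a coloring of
`G` without `uv`. The colors of the other two edges do not conflict, and `v` misses at least `D`
colors after the deletion, so failure to extend determines the colors around `v`
(`IsAcyclicPartial.exists_starExtendable`).

Colorings are partial functions on `Sym2 V`, so that deleting, adding and recoloring an edge are all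
`Function.update`. -/

namespace SimpleGraph

/-! ### Ends of paths in graphs of maximum degree two -/

/-- In a graph of maximum degree two, two paths that start at `u`, avoid a neighbour `s` of `u`
and end at vertices of degree one end at the same vertex. -/
theorem eq_of_isPath_of_degree_le_two {V : Type*} {H : SimpleGraph V}
    (h2 : ∀ x y₁ y₂ y₃, H.Adj x y₁ → H.Adj x y₂ → H.Adj x y₃ → y₁ = y₂ ∨ y₁ = y₃ ∨ y₂ = y₃)
    {v x : V} (hv : ∀ y y', H.Adj v y → H.Adj v y' → y = y')
    (hx : ∀ y y', H.Adj x y → H.Adj x y' → y = y') {u : V} (p : H.Walk u v) :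
    ∀ (s : V) (q : H.Walk u x), p.IsPath → q.IsPath → H.Adj s u → s ∉ p.support →
      s ∉ q.support → v = x := by
  induction p with
  | nil =>
    intro s q _ _ hs _ hq
    cases q with
    | nil => rfl
    | cons h q' =>
      have := hv _ _ hs.symm h
      subst this
      simp at hq
  | @cons u w v h p' ih =>
    intro s q hp hq hs hps hqs
    cases q with
    | nil =>
      have := hx _ _ hs.symm h
      subst this
      simp at hps
    | @cons _ w' _ h' q' =>
      have hw : w = w' := by
        rcases h2 _ _ _ _ hs.symm h h' with e | e | e
        · subst e; simp at hps
        · subst e; simp at hqs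
        · exact e
      subst hw
      rw [Walk.cons_isPath_iff] at hp hq
      exact ih hv u q' hp.1 hq.1 h hp.2 hq.2

/-- A component of a graph of maximum degree two has at most two vertices of degree at most
one. -/
theorem not_reachable_of_three_ends {V : Type*} {H : SimpleGraph V}
    (h2 : ∀ x y₁ y₂ y₃, H.Adj x y₁ → H.Adj x y₂ → H.Adj x y₃ → y₁ = y₂ ∨ y₁ = y₃ ∨ y₂ = y₃)
    {u v x : V} (hu : ∀ y y', H.Adj u y → H.Adj u y' → y = y')
    (hv : ∀ y y', H.Adj v y → H.Adj v y' → y = y')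
    (hx : ∀ y y', H.Adj x y → H.Adj x y' → y = y') (huv : u ≠ v) (hux : u ≠ x) (hvx : v ≠ x)
    (h : H.Reachable u v) : ¬ H.Reachable u x := by
  intro h'
  obtain ⟨p, hp⟩ := h.exists_isPath
  obtain ⟨q, hq⟩ := h'.exists_isPath
  cases p with
  | nil => exact huv rfl
  | @cons _ w _ hw p' =>
    cases q with
    | nil => exact hux rfl
    | @cons _ w' _ hw' q' =>
      have := hu _ _ hw hw'
      subst this
      rw [Walk.cons_isPath_iff] at hp hq
      exact hvx (eq_of_isPath_of_degree_le_two h2 hv hx p' u q' hp.1 hq.1 hw hp.2 hq.2)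

/-- Attaching a pendant edge at an isolated vertex `u` does not connect other vertices. -/
theorem Reachable.of_sup_edge_isolated {V : Type*} {H : SimpleGraph V} {u v : V}
    (hu : ∀ y, ¬ H.Adj u y) {x y : V} (h : (H ⊔ edge u v).Reachable x y) (hx : x ≠ u)
    (hy : y ≠ u) : H.Reachable x y := by
  classical
  -- Moving `u` to `v` collapses the pendant edge and fixes every other vertex.
  have key : ∀ x y, (H ⊔ edge u v).Reachable x y →
      H.Reachable (if x = u then v else x) (if y = u then v else y) := by
    rintro x y ⟨p⟩
    induction p with
    | nil => rfl
    | @cons x z y h p ih =>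
      refine Reachable.trans ?_ ih
      rw [sup_adj, edge_adj] at h
      rcases h with h | ⟨⟨rfl, rfl⟩ | ⟨rfl, rfl⟩, hne⟩
      · have hx : x ≠ u := fun e => hu z (e ▸ h)
        have hz : z ≠ u := fun e => hu x (e ▸ h.symm)
        rw [if_neg hx, if_neg hz]
        exact h.reachable
      · rw [if_pos rfl, if_neg hne.symm]
      · rw [if_pos rfl, if_neg hne]
  simpa [hx, hy] using key x y h

/-! ### Partial acyclic edge colorings and their two-colored paths -/

section Colorings

variable {V C : Type*}

/-- The subgraph of the edges that the partial edge coloring `c` colors with `a` or `b`. -/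
def twoColor (c : Sym2 V → Option C) (a b : C) : SimpleGraph V where
  Adj x y := x ≠ y ∧ (c s(x, y) = some a ∨ c s(x, y) = some b)
  symm := ⟨fun x y h => by rwa [ne_comm, Sym2.eq_swap]⟩

theorem twoColor_comm (c : Sym2 V → Option C) (a b : C) : twoColor c a b = twoColor c b a := by
  ext x y
  simp [twoColor, or_comm]

/-- `c` is an acyclic edge coloring of `G`, given as a partial function that is defined on the
edges of `G`. -/
structure IsAcyclicPartial (G : SimpleGraph V) (c : Sym2 V → Option C) : Prop where
  adj_iff : ∀ x y, G.Adj x y ↔ c s(x, y) ≠ none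
  proper : ∀ x y z a, c s(x, y) = some a → c s(x, z) = some a → y = z
  acyclic : ∀ a b, (twoColor c a b).IsAcyclic

variable {G : SimpleGraph V} {c : Sym2 V → Option C}

namespace IsAcyclicPartial

theorem ne_of_eq_some (hc : IsAcyclicPartial G c) {x y : V} {a : C} (h : c s(x, y) = some a) :
    x ≠ y := by
  rintro rfl
  exact (G.loopless.irrefl x) ((hc.adj_iff x x).2 (by simp [h]))

theorem adj (hc : IsAcyclicPartial G c) {x y : V} {a : C} (h : c s(x, y) = some a) :
    G.Adj x y := (hc.adj_iff x y).2 (by simp [h])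

theorem twoColor_degree (hc : IsAcyclicPartial G c) (a b : C) (x y₁ y₂ y₃ : V)
    (h₁ : (twoColor c a b).Adj x y₁) (h₂ : (twoColor c a b).Adj x y₂)
    (h₃ : (twoColor c a b).Adj x y₃) : y₁ = y₂ ∨ y₁ = y₃ ∨ y₂ = y₃ := by
  have := hc.proper x
  rcases h₁ with ⟨-, h₁⟩
  rcases h₂ with ⟨-, h₂⟩
  rcases h₃ with ⟨-, h₃⟩
  grind

end IsAcyclicPartial

section Update

variable [DecidableEq V]

open Function

theorem update_apply_of_ne {x y z w : V} {o : Option C}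
    (h : z ≠ x) (h' : z ≠ y) : update c s(x, y) o s(z, w) = c s(z, w) := by
  rw [update_of_ne]
  simp only [ne_eq, Sym2.eq_iff]
  tauto

theorem twoColor_update_le {x y : V} {a s t : C} :
    twoColor (update c s(x, y) (some a)) s t ≤ twoColor c s t ⊔ edge x y := by
  intro z w h
  rw [sup_adj, edge_adj]
  simp only [twoColor, update_apply, Sym2.eq_iff] at h ⊢
  grind

theorem twoColor_update_le_of_ne {x y : V} {a s t : C} (hs : a ≠ s) (ht : a ≠ t) :
    twoColor (update c s(x, y) (some a)) s t ≤ twoColor c s t := by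
  intro z w h
  simp only [twoColor, update_apply, Sym2.eq_iff] at h ⊢
  grind

theorem IsAcyclicPartial.erase (hc : IsAcyclicPartial G c) (x y : V) :
    IsAcyclicPartial (G.deleteEdges {s(x, y)}) (update c s(x, y) none) where
  adj_iff z w := by
    rw [deleteEdges_adj, hc.adj_iff]
    simp only [update_apply, Set.mem_singleton_iff]
    grind
  proper z w w' b h₁ h₂ := by
    have h3 := hc.proper z
    simp only [update_apply] at h₁ h₂
    grind
  acyclic s t := by
    refine (hc.acyclic s t).anti fun z w h => ?_
    simp only [twoColor, update_apply] at h ⊢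
    grind

end Update

section Used

variable [Fintype C]

open Classical in
/-- The set of colors that appear at the vertex `x`. -/
noncomputable def used (c : Sym2 V → Option C) (x : V) : Finset C :=
  Finset.univ.filter fun a => ∃ y, c s(x, y) = some a

theorem mem_used {x : V} {a : C} :
    a ∈ used c x ↔ ∃ y, c s(x, y) = some a := by
  simp [used]

theorem mem_used_left {x y : V} {a : C} (h : c s(x, y) = some a) :
    a ∈ used c x := mem_used.2 ⟨y, h⟩

theorem mem_used_right {x y : V} {a : C} (h : c s(x, y) = some a) :
    a ∈ used c y := mem_used.2 ⟨x, by rwa [Sym2.eq_swap]⟩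

namespace IsAcyclicPartial

theorem twoColor_end (hc : IsAcyclicPartial G c) {a b : C} {x : V}
    (hx : a ∉ used c x ∨ b ∉ used c x) (y y' : V) (h : (twoColor c a b).Adj x y)
    (h' : (twoColor c a b).Adj x y') : y = y' := by
  have := hc.proper x
  have h1 : ∀ y a, c s(x, y) = some a → a ∈ used c x := fun y a => mem_used_left
  rcases h with ⟨-, h⟩
  rcases h' with ⟨-, h'⟩
  grind

/-- The ends of two-colored paths: at most two vertices of a two-colored component miss one of
the two colors. -/
theorem not_reachable (hc : IsAcyclicPartial G c) {a b : C} {x y z : V}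
    (hx : a ∉ used c x ∨ b ∉ used c x) (hy : a ∉ used c y ∨ b ∉ used c y)
    (hz : a ∉ used c z ∨ b ∉ used c z) (hxy : x ≠ y) (hxz : x ≠ z) (hyz : y ≠ z)
    (h : (twoColor c a b).Reachable x y) : ¬ (twoColor c a b).Reachable x z :=
  not_reachable_of_three_ends (hc.twoColor_degree a b) (hc.twoColor_end hx)
    (hc.twoColor_end hy) (hc.twoColor_end hz) hxy hxz hyz h

end IsAcyclicPartial

theorem mem_used_of_reachable {a b : C} {x y : V} (hxy : x ≠ y)
    (h : (twoColor c a b).Reachable x y) : a ∈ used c x ∨ b ∈ used c x := by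
  obtain ⟨p⟩ := h
  cases p with
  | nil => exact absurd rfl hxy
  | cons h p =>
    rcases h.2 with h | h
    · exact .inl (mem_used_left h)
    · exact .inr (mem_used_left h)

/-- A two-colored path from `x` starts with an edge `xz` of the color that is present at `x`, and
goes on from `z` with the other color. -/
theorem IsAcyclicPartial.exists_of_reachable (hc : IsAcyclicPartial G c) {a b : C} {x y : V}
    (hxy : x ≠ y) (hx : a ∉ used c x) (hy : b ∉ used c y)
    (h : (twoColor c a b).Reachable x y) : ∃ z, c s(x, z) = some b ∧ a ∈ used c z := by
  have hb : b ∈ used c x := (mem_used_of_reachable hxy h).resolve_left hx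
  obtain ⟨z, hz⟩ := mem_used.1 hb
  refine ⟨z, hz, by_contra fun ha => ?_⟩
  have hzy : y ≠ z := by rintro rfl; exact hy (mem_used_right hz)
  have hxz := hc.ne_of_eq_some hz
  -- If `z` missed `a`, it would be a third end in the component of `x` and `y`.
  exact hc.not_reachable (.inl hx) (.inr hy) (.inl ha) hxy hxz hzy h
    (Adj.reachable ⟨hxz, .inr hz⟩)

section Update

variable [DecidableEq V]

open Function

theorem mem_used_update_left_of_none {x y : V} {a s : C} (hxy : c s(x, y) = none) :
    s ∈ used (update c s(x, y) (some a)) x ↔ s = a ∨ s ∈ used c x := by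
  simp only [mem_used, update_apply, Sym2.eq_iff]
  grind

theorem used_update_of_ne {x y z : V} {o : Option C} (hx : z ≠ x) (hy : z ≠ y) :
    used (update c s(x, y) o) z = used c z := by
  ext s
  simp only [mem_used, update_apply, Sym2.eq_iff]
  grind

theorem IsAcyclicPartial.mem_used_update_left (hc : IsAcyclicPartial G c) {x y : V} {a b s : C}
    (hxy : c s(x, y) = some b) :
    s ∈ used (update c s(x, y) (some a)) x ↔ s = a ∨ (s ∈ used c x ∧ s ≠ b) := by
  have := hc.proper x
  simp only [mem_used, update_apply, Sym2.eq_iff]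
  grind

theorem IsAcyclicPartial.mem_used_update_none_left (hc : IsAcyclicPartial G c) {x y : V}
    {b s : C} (hxy : c s(x, y) = some b) :
    s ∈ used (update c s(x, y) none) x ↔ s ∈ used c x ∧ s ≠ b := by
  have := hc.proper x
  simp only [mem_used, update_apply, Sym2.eq_iff]
  grind

theorem IsAcyclicPartial.mem_used_update_none_right (hc : IsAcyclicPartial G c) {x y : V}
    {b s : C} (hxy : c s(x, y) = some b) :
    s ∈ used (update c s(x, y) none) y ↔ s ∈ used c y ∧ s ≠ b := by
  rw [Sym2.eq_swap] at hxy ⊢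
  exact hc.mem_used_update_none_left hxy

/-- Coloring a new edge: the extension is acyclic if no two-colored path joins the ends. -/
theorem IsAcyclicPartial.add (hc : IsAcyclicPartial G c) {x y : V} {a : C} (hxy : x ≠ y)
    (hx : a ∉ used c x) (hy : a ∉ used c y)
    (h : ∀ b, ¬ (twoColor c a b).Reachable x y) :
    IsAcyclicPartial (G ⊔ edge x y) (update c s(x, y) (some a)) where
  adj_iff z w := by
    rw [sup_adj, hc.adj_iff, edge_adj]
    simp only [update_apply, Sym2.eq_iff]
    grind
  proper z w w' b h₁ h₂ := by
    have h3 := hc.proper z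
    have hx' : ∀ y', c s(x, y') ≠ some a := fun y' h => hx (mem_used_left h)
    have hy' : ∀ y', c s(y, y') ≠ some a := fun y' h => hy (mem_used_left h)
    simp only [update_apply, Sym2.eq_iff] at h₁ h₂
    grind
  acyclic s t := by
    by_cases hs : a = s
    · subst hs
      exact IsAcyclic.anti twoColor_update_le
        (IsAcyclic.sup_edge_of_not_reachable (h t) (hc.acyclic _ _))
    by_cases ht : a = t
    · subst ht
      refine IsAcyclic.anti twoColor_update_le
        (IsAcyclic.sup_edge_of_not_reachable ?_ (hc.acyclic _ _))
      rw [twoColor_comm]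
      exact h s
    · exact (hc.acyclic s t).anti (twoColor_update_le_of_ne hs ht)

/-- Recoloring the edge `xy` with a color that is missing at both ends keeps the coloring acyclic
if the old color of `xy` is the only color that appears at both ends. -/
theorem IsAcyclicPartial.recolor (hc : IsAcyclicPartial G c) {x y : V} {a b : C}
    (hxy : c s(x, y) = some b) (hx : a ∉ used c x) (hy : a ∉ used c y)
    (h : ∀ s ∈ used c x, s ∈ used c y → s = b) :
    IsAcyclicPartial G (update c s(x, y) (some a)) := by
  have hne := hc.ne_of_eq_some hxy
  have hx' : a ∉ used (update c s(x, y) none) x := fun h =>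
    hx ((hc.mem_used_update_none_left hxy).1 h).1
  have hy' : a ∉ used (update c s(x, y) none) y := fun h =>
    hy ((hc.mem_used_update_none_right hxy).1 h).1
  -- With `xy` erased, no color is seen at both ends, whereas a path in `a` and `s` would need `s`
  -- at both.
  have := (hc.erase x y).add hne hx' hy' (fun s hs => by
    have h1 := (mem_used_of_reachable hne hs).resolve_left hx'
    have h2 := (mem_used_of_reachable hne.symm hs.symm).resolve_left hy'
    rw [hc.mem_used_update_none_left hxy] at h1
    rw [hc.mem_used_update_none_right hxy] at h2
    exact h1.2 (h s h1.1 h2.1))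
  rw [update_idem] at this
  convert this using 1
  ext z w
  have := hc.adj hxy
  rw [sup_adj, deleteEdges_adj, edge_adj, Set.mem_singleton_iff, Sym2.eq_iff]
  grind [SimpleGraph.adj_comm, SimpleGraph.Adj.ne]

end Update

end Used

end Colorings

/-! ### Putting back a star at an isolated vertex -/

section StarExtension

open Function

variable {V C : Type*} [Fintype C] {G : SimpleGraph V} {c : Sym2 V → Option C}

/-- The vertices `v`, `w` and `x` have distinct missing colors without two-colored paths between
them, so that `c` extends to a new common neighbor of `v`, `w` and `x`. -/
def StarExtendable (c : Sym2 V → Option C) (v w x : V) : Prop :=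
  ∃ α β γ, α ∉ used c v ∧ β ∉ used c w ∧ γ ∉ used c x ∧ α ≠ β ∧ α ≠ γ ∧ β ≠ γ ∧
    ¬ (twoColor c α β).Reachable v w ∧ ¬ (twoColor c α γ).Reachable v x ∧
    ¬ (twoColor c β γ).Reachable w x

theorem StarExtendable.swap_right {v w x : V} (h : StarExtendable c v w x) :
    StarExtendable c v x w := by
  obtain ⟨α, β, γ, h1, h2, h3, h4, h5, h6, h7, h8, h9⟩ := h
  refine ⟨α, γ, β, h1, h3, h2, h5, h4, h6.symm, h8, h7, fun h => h9 ?_⟩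
  rw [twoColor_comm]
  exact h.symm

theorem StarExtendable.swap_left {v w x : V} (h : StarExtendable c v w x) :
    StarExtendable c w v x := by
  obtain ⟨α, β, γ, h1, h2, h3, h4, h5, h6, h7, h8, h9⟩ := h
  refine ⟨β, α, γ, h2, h1, h3, h4.symm, h6, h5, fun h => h7 ?_, h9, h8⟩
  rw [twoColor_comm]
  exact h.symm

theorem not_adj_twoColor {u : V} (hu : used c u = ∅) (s t : C) (y : V) :
    ¬ (twoColor c s t).Adj u y := by
  rintro ⟨-, h | h⟩
  · simpa [hu] using mem_used_left h
  · simpa [hu] using mem_used_left h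

theorem reachable_of_sup_edge {u v x : V} {s t : C} (hu : used c u = ∅) (hv : v ≠ u)
    (hx : x ≠ u) (h : (twoColor c s t ⊔ edge u v).Reachable u x) :
    (twoColor c s t).Reachable v x := by
  refine Reachable.of_sup_edge_isolated (not_adj_twoColor hu s t) (Reachable.trans ?_ h) hv hx
  refine Adj.reachable ?_
  rw [sup_adj, edge_adj]
  exact .inr ⟨.inr ⟨rfl, rfl⟩, hv⟩

theorem eq_none_of_used_eq_empty {u v : V} (hu : used c u = ∅) : c s(u, v) = none := by
  rw [Option.eq_none_iff_forall_ne_some]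
  intro a h
  simpa [hu] using mem_used_left h

theorem IsAcyclicPartial.card_used_le [Finite V] (hc : IsAcyclicPartial G c) (x : V) :
    (used c x).card ≤ (G.neighborSet x).ncard := by
  have : Nonempty V := ⟨x⟩
  rw [← Set.ncard_coe_finset]
  have h : ∀ a ∈ (used c x : Set C), ∃ y, c s(x, y) = some a := fun a ha => mem_used.1 ha
  choose! f hf using h
  refine Set.ncard_le_ncard_of_injOn f (fun a ha => hc.adj (hf a ha)) (fun a ha b hb e => ?_)
    (Set.toFinite _)
  have h1 := hf a ha
  rw [e, hf b hb] at h1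
  exact (Option.some_injective _ h1).symm

theorem IsAcyclicPartial.used_eq_empty (hc : IsAcyclicPartial G c) {u : V}
    (hu : ∀ y, ¬ G.Adj u y) : used c u = ∅ := by
  ext a
  simp only [Finset.notMem_empty, iff_false]
  intro h
  obtain ⟨y, hy⟩ := mem_used.1 h
  exact hu y (hc.adj hy)

variable [DecidableEq V]

theorem IsAcyclicPartial.add_pendant (hc : IsAcyclicPartial G c) {u v : V} {α : C}
    (hu : used c u = ∅) (huv : u ≠ v) (hα : α ∉ used c v) :
    IsAcyclicPartial (G ⊔ edge u v) (update c s(u, v) (some α)) := by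
  refine hc.add huv (by simp [hu]) hα fun b h => ?_
  have := mem_used_of_reachable huv h
  simp [hu] at this

theorem IsAcyclicPartial.add_cherry (hc : IsAcyclicPartial G c) {u v w : V} {α β : C}
    (hu : used c u = ∅) (huv : u ≠ v) (huw : u ≠ w) (hvw : v ≠ w)
    (hα : α ∉ used c v) (hβ : β ∉ used c w) (hαβ : α ≠ β)
    (h : ¬ (twoColor c α β).Reachable v w) :
    IsAcyclicPartial (G ⊔ edge u v ⊔ edge u w)
      (update (update c s(u, v) (some α)) s(u, w) (some β)) := by
  have hm : ∀ s, s ∈ used (update c s(u, v) (some α)) u ↔ s = α := fun s => by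
    rw [mem_used_update_left_of_none (eq_none_of_used_eq_empty hu)]
    simp [hu]
  have hβu : β ∉ used (update c s(u, v) (some α)) u := by
    rw [hm]
    exact hαβ.symm
  refine (hc.add_pendant hu huv hα).add huw hβu ?_ fun b hb => ?_
  · rwa [used_update_of_ne huw.symm hvw.symm]
  · have := (mem_used_of_reachable huw hb).resolve_left hβu
    rw [hm] at this
    subst this
    rw [twoColor_comm] at hb
    exact h (reachable_of_sup_edge hu huv.symm huw.symm (hb.mono twoColor_update_le))

/-- A two-colored path from `u` to the end of the last edge must leave `u` by one of the earlier
star edges. Since `u` was isolated, the rest of that path already lies in the old coloring, where it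
is excluded. -/
theorem IsAcyclicPartial.exists_of_starExtendable (hc : IsAcyclicPartial G c) {u v w x : V}
    (hu : used c u = ∅) (huv : u ≠ v) (huw : u ≠ w) (hux : u ≠ x) (hvw : v ≠ w) (hvx : v ≠ x)
    (hwx : w ≠ x) (h : StarExtendable c v w x) :
    ∃ c' : Sym2 V → Option C, IsAcyclicPartial (G ⊔ edge u v ⊔ edge u w ⊔ edge u x) c' := by
  obtain ⟨α, β, γ, hα, hβ, hγ, hαβ, hαγ, hβγ, h1, h2, h3⟩ := h
  have hn : update c s(u, v) (some α) s(u, w) = none := by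
    rw [Sym2.eq_swap (a := u) (b := w), update_apply_of_ne huw.symm hvw.symm, Sym2.eq_swap]
    exact eq_none_of_used_eq_empty hu
  have hm : ∀ s, s ∈ used (update (update c s(u, v) (some α)) s(u, w) (some β)) u ↔
      s = β ∨ s = α := fun s => by
    rw [mem_used_update_left_of_none hn,
      mem_used_update_left_of_none (eq_none_of_used_eq_empty hu)]
    simp [hu]
  have hγu : γ ∉ used (update (update c s(u, v) (some α)) s(u, w) (some β)) u := by
    rw [hm]
    tauto
  refine ⟨_, (hc.add_cherry hu huv huw hvw hα hβ hαβ h1).add hux hγu ?_ fun b hb => ?_⟩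
  · rwa [used_update_of_ne hux.symm hwx.symm, used_update_of_ne hux.symm hvx.symm]
  · have := (mem_used_of_reachable hux hb).resolve_left hγu
    rw [hm] at this
    rw [twoColor_comm] at hb
    rcases this with rfl | rfl
    · refine h3 (reachable_of_sup_edge hu huw.symm hux.symm (hb.mono ?_))
      exact twoColor_update_le.trans (sup_le_sup_right (twoColor_update_le_of_ne hαβ hαγ) _)
    · refine h2 (reachable_of_sup_edge hu huv.symm hux.symm (hb.mono ?_))
      exact (twoColor_update_le_of_ne hαβ.symm hβγ).trans twoColor_update_le

end StarExtension

/-! ### Three hubs: recoloring away the conflicts -/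

section Hubs

open Function

variable {V C : Type*} [Fintype C] {G : SimpleGraph V}

/-- At least three colors of `C` are missing at `z` in every proper edge coloring, and the
neighbors of `z` have degree at most three. -/
structure IsHub (G : SimpleGraph V) (C : Type*) [Fintype C] (z : V) : Prop where
  degree_le : (G.neighborSet z).ncard + 3 ≤ Fintype.card C
  neighbor_degree_le : ∀ y, G.Adj z y → (G.neighborSet y).ncard ≤ 3

/-- Three distinct, pairwise non-adjacent hubs. -/
structure IsHubTriple (G : SimpleGraph V) (C : Type*) [Fintype C] (v w x : V) : Prop where
  hub₁ : IsHub G C v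
  hub₂ : IsHub G C w
  hub₃ : IsHub G C x
  ne₁₂ : v ≠ w
  ne₁₃ : v ≠ x
  ne₂₃ : w ≠ x
  not_adj₁₂ : ¬ G.Adj v w
  not_adj₁₃ : ¬ G.Adj v x
  not_adj₂₃ : ¬ G.Adj w x

theorem IsHubTriple.swap_left {v w x : V} (h : IsHubTriple G C v w x) : IsHubTriple G C w v x :=
  ⟨h.hub₂, h.hub₁, h.hub₃, h.ne₁₂.symm, h.ne₂₃, h.ne₁₃, fun e => h.not_adj₁₂ e.symm,
    h.not_adj₂₃, h.not_adj₁₃⟩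

theorem IsHubTriple.swap_right {v w x : V} (h : IsHubTriple G C v w x) : IsHubTriple G C v x w :=
  ⟨h.hub₁, h.hub₃, h.hub₂, h.ne₁₃, h.ne₁₂, h.ne₂₃.symm, h.not_adj₁₃, h.not_adj₁₂,
    fun e => h.not_adj₂₃ e.symm⟩

variable [Finite V] [DecidableEq C] {c : Sym2 V → Option C}

theorem IsAcyclicPartial.card_compl_used (hc : IsAcyclicPartial G c) {z : V} {n : ℕ}
    (h : (G.neighborSet z).ncard + n ≤ Fintype.card C) : n ≤ (used c z)ᶜ.card := by
  rw [Finset.card_compl]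
  have := hc.card_used_le z
  omega

/-- If the color `b`, missing at `z`, conflicts at `y` with all of the missing colors in `T`, then
the edge at `y` of color `b` has `T` as its set of adjacent colors at the other end. -/
theorem IsAcyclicPartial.exists_neighbor (hc : IsAcyclicPartial G c) {y z : V} (hy : IsHub G C y)
    (hyz : y ≠ z) {b : C} (hb : b ∉ used c z) {T : Finset C} (hT : 2 ≤ T.card)
    (hTy : ∀ t ∈ T, t ∉ used c y) (h : ∀ t ∈ T, (twoColor c t b).Reachable y z) :
    T.card = 2 ∧ ∃ y', c s(y, y') = some b ∧ ∀ s, s ∈ used c y' ↔ s = b ∨ s ∈ T := by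
  obtain ⟨t₀, ht₀⟩ := Finset.card_pos.1 (by omega : 0 < T.card)
  obtain ⟨y', hy', -⟩ := hc.exists_of_reachable hyz (hTy t₀ ht₀) hb (h t₀ ht₀)
  have hbT : b ∉ T := fun e => hTy b e (mem_used_left hy')
  have hsub : insert b T ⊆ used c y' := by
    intro s hs
    rcases Finset.mem_insert.1 hs with rfl | hs
    · exact mem_used_right hy'
    · obtain ⟨y'', hy'', h'⟩ := hc.exists_of_reachable hyz (hTy s hs) hb (h s hs)
      rwa [hc.proper _ _ _ _ hy' hy'']
  -- Degree at most three leaves room for two colors besides `b`.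
  have h3 := (hc.card_used_le y').trans (hy.neighbor_degree_le y' (hc.adj hy'))
  have h4 := Finset.card_le_card hsub
  rw [Finset.card_insert_of_notMem hbT] at h4
  refine ⟨by omega, y', hy', fun s => ?_⟩
  rw [← Finset.eq_of_subset_of_card_le hsub
    (by rw [Finset.card_insert_of_notMem hbT]; omega), Finset.mem_insert]

/-- If three hubs have a common missing color `a`, then the other missing colors at two of them
are in conflict. -/
theorem IsAcyclicPartial.exists_neighbor_of_common (hc : IsAcyclicPartial G c) {v w x : V}
    (ht : IsHubTriple G C v w x) (hno : ¬ StarExtendable c v w x) {a : C} (hv : a ∉ used c v)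
    (hw : a ∉ used c w) (hx : a ∉ used c x) :
    (∀ s, s ∉ used c w → s ∉ used c x → s = a) ∧ ∀ b, b ∉ used c x → b ≠ a →
      ∃ y, c s(w, y) = some b ∧ ∀ s, s ∈ used c y ↔ s = b ∨ (s ∉ used c w ∧ s ≠ a) := by
  have h1 : ∀ β γ, β ∉ used c w → β ≠ a → γ ∉ used c x → γ ≠ a → β ≠ γ →
      (twoColor c β γ).Reachable w x := by
    intro β γ hβ hβa hγ hγa hβγ
    by_contra h
    -- With `a` at `v`, no conflict involves `v`: `w` misses both `a` and `β`, and `x` misses both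
    -- `a` and `γ`.
    refine hno ⟨a, β, γ, hv, hβ, hγ, hβa.symm, hγa.symm, hβγ, fun h => ?_, fun h => ?_, h⟩
    · exact (mem_used_of_reachable ht.ne₁₂.symm h.symm).elim hw hβ
    · exact (mem_used_of_reachable ht.ne₁₃.symm h.symm).elim hx hγ
  have h3 := hc.card_compl_used ht.hub₂.degree_le
  have hw2 : 2 ≤ ((used c w)ᶜ.erase a).card := by
    rw [Finset.card_erase_of_mem (by simpa using hw)]
    omega
  have h2 : ∀ s, s ∉ used c w → s ∉ used c x → s = a := by
    intro s hsw hsx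
    by_contra hsa
    obtain ⟨β, hβ, hβs⟩ := Finset.exists_mem_ne (by omega) s (s := (used c w)ᶜ.erase a)
    rw [Finset.mem_erase, Finset.mem_compl] at hβ
    exact (mem_used_of_reachable ht.ne₂₃ (h1 β s hβ.2 hβ.1 hsx hsa hβs)).elim hβ.2 hsw
  refine ⟨h2, fun b hb hba => ?_⟩
  obtain ⟨-, y, hy, h⟩ := hc.exists_neighbor ht.hub₂ ht.ne₂₃ hb hw2 (fun t ht => by simp_all)
    (fun t ht => by
      rw [Finset.mem_erase, Finset.mem_compl] at ht
      exact h1 t b ht.2 ht.1 hb hba fun e => hba (h2 b (e ▸ ht.2) hb))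
  refine ⟨y, hy, fun s => ?_⟩
  rw [h, Finset.mem_erase, Finset.mem_compl]
  tauto

/-- Recoloring the `γ`-edge at `w` with `a` makes `γ` missing at `w` as well as at `x`. Then `a`,
`β`, `γ` work: only an `a`/`β` path from `v` remains possible, and it stops at `v'`, which misses
`a`. -/
theorem IsAcyclicPartial.false_of_common_three [DecidableEq V] (hc : IsAcyclicPartial G c)
    {v w x : V} (ht : IsHubTriple G C v w x)
    (hno : ∀ c : Sym2 V → Option C, IsAcyclicPartial G c → ¬ StarExtendable c v w x) {a : C}
    (hv : a ∉ used c v) (hw : a ∉ used c w) (hx : a ∉ used c x) : False := by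
  obtain ⟨h23, hN⟩ := hc.exists_neighbor_of_common ht (hno c hc) hv hw hx
  obtain ⟨h12, hN'⟩ := hc.exists_neighbor_of_common (v := x) (w := v) (x := w)
    ht.swap_right.swap_left (fun h => hno c hc h.swap_left.swap_right) hx hv hw
  obtain ⟨h13, -⟩ := hc.exists_neighbor_of_common (v := w) (w := v) (x := x)
    ht.swap_left (fun h => hno c hc h.swap_left) hw hv hx
  have pick : ∀ z, IsHub G C z → ∃ s, s ∉ used c z ∧ s ≠ a := fun z hz => by
    obtain ⟨s, hs, hsa⟩ := Finset.exists_mem_ne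
      (by have := hc.card_compl_used hz.degree_le; omega) a (s := (used c z)ᶜ)
    exact ⟨s, by simpa using hs, hsa⟩
  obtain ⟨β, hβ, hβa⟩ := pick w ht.hub₂
  obtain ⟨γ, hγ, hγa⟩ := pick x ht.hub₃
  obtain ⟨δ, hδ, hδa⟩ := pick v ht.hub₁
  obtain ⟨w', hw', hSw⟩ := hN γ hγ hγa
  obtain ⟨v', hv', hSv⟩ := hN' β hβ hβa
  have hγw : γ ∈ used c w := mem_used_left hw'
  have hβγ : β ≠ γ := fun e => hβ (e ▸ hγw)
  have hd : IsAcyclicPartial G (update c s(w, w') (some a)) :=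
    hc.recolor hw' hw (by rw [hSw]; tauto) (fun s h h' => by rw [hSw] at h'; tauto)
  have hvw' : v ≠ w' := by rintro rfl; exact ht.not_adj₁₂ (hc.adj hw').symm
  have hxw' : x ≠ w' := by rintro rfl; exact ht.not_adj₂₃ (hc.adj hw')
  have hv'w : v' ≠ w := by rintro rfl; exact ht.not_adj₁₂ (hc.adj hv')
  -- Otherwise `δ`, seen at `v'`, would be `γ` or missing at `w`; no color but `a` is missing at two
  -- of the hubs.
  have hv'w' : v' ≠ w' := by
    rintro rfl
    have h1 := hSw δ
    rw [hSv δ] at h1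
    rcases h1.1 (.inr ⟨hδ, hδa⟩) with h | h
    · exact hδa (h13 δ hδ (h ▸ hγ))
    · exact hδa (h12 δ hδ h.1)
  have hdv := used_update_of_ne (c := c) (o := some a) ht.ne₁₂ hvw'
  have hdx := used_update_of_ne (c := c) (o := some a) ht.ne₂₃.symm hxw'
  have hdv' := used_update_of_ne (c := c) (o := some a) hv'w hv'w'
  have hdw : ∀ s, s ∈ used (update c s(w, w') (some a)) w ↔ _ :=
    fun s => hc.mem_used_update_left hw'
  refine hno _ hd ⟨a, β, γ, by rwa [hdv], by rw [hdw]; tauto, by rwa [hdx], hβa.symm, hγa.symm,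
    hβγ, fun h => ?_, fun h => ?_, fun h => ?_⟩
  · obtain ⟨z, hz, haz⟩ := hd.exists_of_reachable ht.ne₁₂ (by rwa [hdv])
      (by rw [hdw]; tauto) h
    rw [update_apply_of_ne ht.ne₁₂ hvw'] at hz
    obtain rfl := hc.proper _ _ _ _ hv' hz
    rw [hdv', hSv] at haz
    rcases haz with h | h
    · exact hβa h.symm
    · exact h.2 rfl
  · have := mem_used_of_reachable ht.ne₁₃.symm h.symm
    rw [hdx] at this
    tauto
  · have := mem_used_of_reachable ht.ne₂₃ h
    rw [hdw, hdw] at this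
    tauto

/-- Give `p` to `w` and `q` to `x`. Since `v` also misses `p`, no color at `v` conflicts with `w`,
so every remaining candidate at `v` must conflict with `q`, and `exists_neighbor` applies. -/
theorem IsAcyclicPartial.exists_neighbor_of_common_two (hc : IsAcyclicPartial G c) {v w x : V}
    (ht : IsHubTriple G C v w x) (hno : ¬ StarExtendable c v w x) {p q : C}
    (hv : p ∉ used c v) (hw : p ∉ used c w) (hx : q ∉ used c x) (hpq : p ≠ q)
    (h : ¬ (twoColor c p q).Reachable w x) :
    ∃ y, c s(v, y) = some q ∧ ∀ s, s ∈ used c y ↔ s = q ∨ (s ∉ used c v ∧ s ≠ p) := by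
  have h1 : ∀ α, α ∉ used c v → α ≠ p → α ≠ q → (twoColor c α q).Reachable v x := by
    intro α hα hαp hαq
    by_contra h'
    refine hno ⟨α, p, q, hα, hw, hx, hαp, hαq, hpq, fun h => ?_, h', h⟩
    exact (mem_used_of_reachable ht.ne₁₂ h).elim hα hv
  have h3 := hc.card_compl_used ht.hub₁.degree_le
  have hv2 : 2 ≤ ((used c v)ᶜ.erase p).card := by
    rw [Finset.card_erase_of_mem (by simpa using hv)]
    omega
  have hq : q ∈ used c v := by
    by_contra hq
    obtain ⟨α, hα, hαq⟩ := Finset.exists_mem_ne (by omega) q (s := (used c v)ᶜ.erase p)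
    rw [Finset.mem_erase, Finset.mem_compl] at hα
    exact (mem_used_of_reachable ht.ne₁₃ (h1 α hα.2 hα.1 hαq)).elim hα.2 hq
  obtain ⟨-, y, hy, h⟩ := hc.exists_neighbor ht.hub₁ ht.ne₁₃ hx hv2 (fun t ht => by simp_all)
    (fun t ht => by
      rw [Finset.mem_erase, Finset.mem_compl] at ht
      exact h1 t ht.2 ht.1 fun e => ht.2 (e ▸ hq))
  refine ⟨y, hy, fun s => ?_⟩
  rw [h, Finset.mem_erase, Finset.mem_compl]
  tauto

/-- Recoloring the `q`-edges at both `v` and `w` with `p` makes `q` missing at all three hubs. -/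
theorem IsAcyclicPartial.false_of_common_two [DecidableEq V] (hc : IsAcyclicPartial G c)
    {v w x : V} (ht : IsHubTriple G C v w x)
    (hno : ∀ c : Sym2 V → Option C, IsAcyclicPartial G c → ¬ StarExtendable c v w x) {p : C}
    (hv : p ∉ used c v) (hw : p ∉ used c w) : False := by
  have hpx : p ∈ used c x := by
    by_contra hx
    exact hc.false_of_common_three ht hno hv hw hx
  -- Otherwise `p` would conflict with at least three colors missing at the hub `x`.
  obtain ⟨q, hq, hnr⟩ : ∃ q, q ∉ used c x ∧ ¬ (twoColor c p q).Reachable w x := by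
    by_contra! hcon
    have h3 := hc.card_compl_used ht.hub₃.degree_le
    have := (hc.exists_neighbor ht.hub₃ ht.ne₂₃.symm hw (T := (used c x)ᶜ) (by omega)
      (fun t ht => by simpa using ht) (fun t ht => by
        rw [twoColor_comm]
        exact (hcon t (by simpa using ht)).symm)).1
    omega
  have hpq : p ≠ q := by rintro rfl; exact hq hpx
  obtain ⟨v', hv', hSv⟩ := hc.exists_neighbor_of_common_two ht (hno c hc) hv hw hq hpq hnr
  obtain ⟨w', hw', hSw⟩ := hc.exists_neighbor_of_common_two ht.swap_left
    -- A `p`/`q` path from `v` would pass through `v'`, which misses `p`.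
    (fun h => hno c hc h.swap_left) hw hv hq hpq (fun h => by
      obtain ⟨z, hz, hpz⟩ := hc.exists_of_reachable ht.ne₁₃ hv hq h
      obtain rfl := hc.proper _ _ _ _ hv' hz
      rw [hSv] at hpz
      tauto)
  have hd : IsAcyclicPartial G (update c s(v, v') (some p)) :=
    hc.recolor hv' hv (by rw [hSv]; tauto) (fun s h h' => by rw [hSv] at h'; tauto)
  have hwv' : w ≠ v' := by rintro rfl; exact ht.not_adj₁₂ (hc.adj hv')
  have hxv' : x ≠ v' := by rintro rfl; exact ht.not_adj₁₃ (hc.adj hv')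
  have hw'v : w' ≠ v := by rintro rfl; exact ht.not_adj₁₂ (hc.adj hw').symm
  have hxw' : x ≠ w' := by rintro rfl; exact ht.not_adj₂₃ (hc.adj hw')
  have hw'v' : w' ≠ v' := by
    rintro rfl
    rw [Sym2.eq_swap] at hv' hw'
    exact ht.ne₁₂ (hc.proper _ _ _ _ hv' hw')
  have hdw := used_update_of_ne (c := c) (o := some p) ht.ne₁₂.symm hwv'
  have hdw' := used_update_of_ne (c := c) (o := some p) hw'v hw'v'
  have hww' : update c s(v, v') (some p) s(w, w') = some q := by
    rw [update_apply_of_ne ht.ne₁₂.symm hwv', hw']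
  have hd' : IsAcyclicPartial G (update (update c s(v, v') (some p)) s(w, w') (some p)) :=
    hd.recolor hww' (by rwa [hdw]) (by rw [hdw', hSw]; tauto)
      (fun s h h' => by rw [hdw', hSw] at h'; rw [hdw] at h; tauto)
  refine hd'.false_of_common_three ht hno (a := q) ?_ ?_ ?_
  · rw [used_update_of_ne ht.ne₁₂ hw'v.symm, hc.mem_used_update_left hv']
    tauto
  · rw [hd.mem_used_update_left hww']
    tauto
  · rwa [used_update_of_ne ht.ne₂₃.symm hxw', used_update_of_ne ht.ne₁₃.symm hxv']

/-- With two conflicts, the `b`-edge at `v` can be recolored with a third missing color, which makes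
`b` missing at both `v` and `w`. -/
theorem IsAcyclicPartial.card_conflict_le_one [DecidableEq V] (hc : IsAcyclicPartial G c)
    {v w x : V} (ht : IsHubTriple G C v w x)
    (hno : ∀ c : Sym2 V → Option C, IsAcyclicPartial G c → ¬ StarExtendable c v w x) {b : C}
    (hb : b ∉ used c w) {T : Finset C} (hT : ∀ t ∈ T, t ∉ used c v)
    (h : ∀ t ∈ T, (twoColor c t b).Reachable v w) : T.card ≤ 1 := by
  by_contra! hT2
  obtain ⟨hcard, y, hy, hS⟩ := hc.exists_neighbor ht.hub₁ ht.ne₁₂ hb hT2 hT h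
  have h3 := hc.card_compl_used ht.hub₁.degree_le
  obtain ⟨a, ha, haT⟩ := Finset.exists_mem_notMem_of_card_lt_card (s := T) (t := (used c v)ᶜ)
    (by omega)
  rw [Finset.mem_compl] at ha
  have hab : a ≠ b := fun e => ha (e ▸ mem_used_left hy)
  have hwy : w ≠ y := by rintro rfl; exact ht.not_adj₁₂ (hc.adj hy)
  have hd : IsAcyclicPartial G (update c s(v, y) (some a)) :=
    hc.recolor hy ha (by rw [hS]; tauto) (fun s h h' => by
      rw [hS] at h'
      exact h'.resolve_right fun e => hT s e h)
  refine hd.false_of_common_two ht hno (p := b) ?_ ?_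
  · rw [hc.mem_used_update_left hy]
    tauto
  · rwa [used_update_of_ne ht.ne₁₂.symm hwy]

/-- The sets of missing colors are now pairwise disjoint and have at least three elements. A greedy
choice works: `α` excludes at most one `β`, and `α` and `β` together exclude at most two `γ`. -/
theorem IsHubTriple.exists_starExtendable [DecidableEq V] {v w x : V}
    (ht : IsHubTriple G C v w x) (hc : IsAcyclicPartial G c) :
    ∃ c : Sym2 V → Option C, IsAcyclicPartial G c ∧ StarExtendable c v w x := by
  classical
  by_contra! hno
  have hv := hc.card_compl_used ht.hub₁.degree_le
  have hw := hc.card_compl_used ht.hub₂.degree_le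
  have hx := hc.card_compl_used ht.hub₃.degree_le
  have hvw : ∀ s, s ∉ used c v → s ∉ used c w → False := fun s => hc.false_of_common_two ht hno
  have hvx : ∀ s, s ∉ used c v → s ∉ used c x → False := fun s =>
    hc.false_of_common_two ht.swap_right (fun c hc h => hno c hc h.swap_right)
  have hwx : ∀ s, s ∉ used c w → s ∉ used c x → False := fun s =>
    hc.false_of_common_two ht.swap_left.swap_right
      (fun c hc h => hno c hc h.swap_right.swap_left)
  obtain ⟨α, hα⟩ := Finset.card_pos.1 (by omega : 0 < (used c v)ᶜ.card)
  rw [Finset.mem_compl] at hα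
  have h1 := hc.card_conflict_le_one ht.swap_left (fun c hc h => hno c hc h.swap_left) hα
    (T := (used c w)ᶜ.filter fun t => (twoColor c t α).Reachable w v) (by simp +contextual) (by simp)
  obtain ⟨β, hβ, hβ'⟩ := Finset.exists_mem_notMem_of_card_lt_card
    (h1.trans_lt (by omega : 1 < (used c w)ᶜ.card))
  have h2 := hc.card_conflict_le_one ht.swap_right.swap_left
    (fun c hc h => hno c hc h.swap_left.swap_right) hα
    (T := (used c x)ᶜ.filter fun t => (twoColor c t α).Reachable x v) (by simp +contextual) (by simp)
  rw [Finset.mem_compl] at hβ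
  have h3 := hc.card_conflict_le_one ht.swap_left.swap_right.swap_left
    (fun c hc h => hno c hc h.swap_left.swap_right.swap_left) hβ
    (T := (used c x)ᶜ.filter fun t => (twoColor c t β).Reachable x w) (by simp +contextual) (by simp)
  obtain ⟨γ, hγ, hγ'⟩ := Finset.exists_mem_notMem_of_card_lt_card
    (lt_of_le_of_lt ((Finset.card_union_le _ _).trans (add_le_add h2 h3))
      (by omega : _ < (used c x)ᶜ.card))
  simp only [Finset.mem_compl, Finset.mem_union, Finset.mem_filter, not_or, not_and] at hγ hγ' hβ'
  refine hno c hc ⟨α, β, γ, hα, hβ, hγ, ?_, ?_, ?_, fun h => hβ' hβ ?_, fun h => hγ'.1 hγ ?_,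
    fun h => hγ'.2 hγ ?_⟩
  · rintro rfl; exact hvw _ hα hβ
  · rintro rfl; exact hvx _ hα hγ
  · rintro rfl; exact hwx _ hβ hγ
  all_goals rw [twoColor_comm]; exact h.symm

/-- Extending a coloring to a new common neighbor of `v` and `w`. -/
theorem IsAcyclicPartial.exists_cherry (hc : IsAcyclicPartial G c) {v w : V} (hvw : v ≠ w)
    (hv : (G.neighborSet v).ncard + 3 ≤ Fintype.card C)
    (hw : (G.neighborSet w).ncard + 3 ≤ Fintype.card C)
    (h : IsHub G C v ∨ (G.neighborSet v).ncard ≤ 2) :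
    ∃ α β, α ∉ used c v ∧ β ∉ used c w ∧ α ≠ β ∧ ¬ (twoColor c α β).Reachable v w := by
  by_contra! hno
  have hv3 := hc.card_compl_used hv
  have hw3 := hc.card_compl_used hw
  have hdis : ∀ β, β ∉ used c w → β ∈ used c v := by
    intro β hβ
    by_contra hβv
    obtain ⟨α, hα, hαβ⟩ := Finset.exists_mem_ne (by omega) β (s := (used c v)ᶜ)
    rw [Finset.mem_compl] at hα
    exact (mem_used_of_reachable hvw (hno α β hα hβ hαβ)).elim hα hβv
  -- Either a hub has three conflicts with one color, or three colors are seen at a vertex of degree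
  -- at most two.
  rcases h with h | h
  · obtain ⟨β, hβ⟩ := Finset.card_pos.1 (by omega : 0 < (used c w)ᶜ.card)
    rw [Finset.mem_compl] at hβ
    have := (hc.exists_neighbor h hvw hβ (T := (used c v)ᶜ) (by omega) (by simp) (fun t ht => by
      rw [Finset.mem_compl] at ht
      exact hno t β ht hβ fun e => ht (e ▸ hdis β hβ))).1
    omega
  · have h1 : (used c w)ᶜ ⊆ used c v := fun β hβ => hdis β (by simpa using hβ)
    have := Finset.card_le_card h1
    have := hc.card_used_le v
    omega

end Hubs

/-! ### A neighbor with at most two remaining edges -/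

section SmallNeighbor

open Function

variable {V C : Type*} [Fintype C] [DecidableEq C] [Finite V] {G : SimpleGraph V}
  {c : Sym2 V → Option C} {D : ℕ}

/-- Keep `a` at `w` and `b` at `x`. Every color other than `b` missing at `v` must then conflict
with `a`, so it is seen both at `w` and at the far end of the `a`-edge at `v`. The degree bounds
turn both inclusions into equalities. -/
theorem IsAcyclicPartial.used_eq_of_conflict (hc : IsAcyclicPartial G c) {v w x : V}
    (hD : Fintype.card C = D + 2) (hdeg : ∀ z, (G.neighborSet z).ncard ≤ D)
    (hv : (G.neighborSet v).ncard ≤ 2) (hw : (G.neighborSet w).ncard + 1 ≤ D)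
    (hvw : v ≠ w) (hvx : v ≠ x)
    (hno : ¬ StarExtendable c v w x) {a b : C} (ha : a ∉ used c w) (hb : b ∉ used c x)
    (hab : a ≠ b) (h : ¬ (twoColor c a b).Reachable w x) (hav : a ∈ used c v)
    (hbv : b ∉ used c v) :
    (∀ α, α ∉ used c v → α ≠ b → (twoColor c α a).Reachable v w) ∧
      (∀ s, s ∈ used c w ↔ s ∉ used c v ∧ s ≠ b) ∧
      ∃ y, c s(v, y) = some a ∧ D ≤ (used c y).card ∧
        ∀ s, s ∈ used c y ↔ s = a ∨ (s ∉ used c v ∧ s ≠ b) := by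
  have h1 : ∀ α, α ∉ used c v → α ≠ b → (twoColor c α a).Reachable v w := by
    intro α hα hαb
    by_contra h'
    refine hno ⟨α, a, b, hα, ha, hb, ?_, hαb, hab, h', fun h => ?_, h⟩
    · rintro rfl; exact hα hav
    · exact (mem_used_of_reachable hvx h).elim hα hbv
  -- Of `D + 2` colors, at most two are seen at `v` and one more is `b`.
  have hcard : D - 1 ≤ ((used c v)ᶜ.erase b).card := by
    rw [Finset.card_erase_of_mem (by simpa using hbv), Finset.card_compl]
    have := hc.card_used_le v
    omega
  have hsub : (used c v)ᶜ.erase b ⊆ used c w := by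
    intro α hα
    rw [Finset.mem_erase, Finset.mem_compl] at hα
    exact (mem_used_of_reachable hvw.symm (h1 α hα.2 hα.1).symm).resolve_right ha
  have heq := Finset.eq_of_subset_of_card_le hsub (by have := hc.card_used_le w; omega)
  obtain ⟨y, hy⟩ := mem_used.1 hav
  have haT : a ∉ (used c v)ᶜ.erase b := by simp [hav]
  have hsub' : insert a ((used c v)ᶜ.erase b) ⊆ used c y := by
    intro s hs
    rcases Finset.mem_insert.1 hs with rfl | hs
    · exact mem_used_right hy
    · rw [Finset.mem_erase, Finset.mem_compl] at hs
      obtain ⟨y', hy', h'⟩ := hc.exists_of_reachable hvw hs.2 ha (h1 s hs.2 hs.1)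
      rwa [hc.proper _ _ _ _ hy hy']
  have hcard' : D ≤ (insert a ((used c v)ᶜ.erase b)).card := by
    rw [Finset.card_insert_of_notMem haT]
    omega
  have heq' := Finset.eq_of_subset_of_card_le hsub'
    (by have := hc.card_used_le y; have := hdeg y; omega)
  refine ⟨h1, fun s => ?_, y, hy, heq' ▸ hcard', fun s => ?_⟩
  · rw [← heq, Finset.mem_erase, Finset.mem_compl, and_comm]
  · rw [← heq', Finset.mem_insert, Finset.mem_erase, Finset.mem_compl, and_comm (a := s ≠ b)]

variable [DecidableEq V]

/-- Recoloring the `a`-edge at `v` with `b` exchanges the roles of `w` and `x`, and the rigidity at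
`x` shows that `a` is missing there too. In the original coloring, `b` can then go to `w` and `a` to
`x`. -/
theorem IsAcyclicPartial.false_of_one_common (hc : IsAcyclicPartial G c) {v w x : V}
    (hD : Fintype.card C = D + 2) (hdeg : ∀ z, (G.neighborSet z).ncard ≤ D)
    (hv : (G.neighborSet v).ncard ≤ 2) (hv' : (G.neighborSet v).ncard + 1 ≤ D)
    (hw : (G.neighborSet w).ncard + 1 ≤ D)
    (hx : (G.neighborSet x).ncard + 1 ≤ D) (hvw : v ≠ w) (hvx : v ≠ x) (hwx : w ≠ x)
    (hno : ∀ c : Sym2 V → Option C, IsAcyclicPartial G c → ¬ StarExtendable c v w x)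
    {a b : C} (ha : a ∉ used c w) (hb : b ∉ used c x)
    (hab : a ≠ b) (h : ¬ (twoColor c a b).Reachable w x) (hav : a ∈ used c v)
    (hbv : b ∉ used c v) : False := by
  obtain ⟨hconf, hSw, y, hy, hyD, hSy⟩ := hc.used_eq_of_conflict hD hdeg hv hw hvw hvx (hno c hc)
    ha hb hab h hav hbv
  have hwy : w ≠ y := by rintro rfl; exact ha (mem_used_right hy)
  have hxy : x ≠ y := by rintro rfl; have := hc.card_used_le x; omega
  have hd : IsAcyclicPartial G (update c s(v, y) (some b)) :=
    hc.recolor hy hbv (by rw [hSy]; tauto) (fun s h h' => by rw [hSy] at h'; tauto)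
  have hdw := used_update_of_ne (c := c) (o := some b) hvw.symm hwy
  have hdx := used_update_of_ne (c := c) (o := some b) hvx.symm hxy
  have hdv : ∀ s, s ∈ used (update c s(v, y) (some b)) v ↔ _ :=
    fun s => hc.mem_used_update_left hy
  have hbw : b ∉ used c w := by rw [hSw]; tauto
  obtain ⟨-, hSx, -⟩ := hd.used_eq_of_conflict hD hdeg hv hx hvx hvw
    (fun h => hno _ hd h.swap_right) (a := b) (b := a) (by rwa [hdx]) (by rwa [hdw]) hab.symm
    (fun h => by
      have := mem_used_of_reachable hwx h.symm
      rw [hdw] at this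
      tauto)
    (by rw [hdv]; tauto) (by rw [hdv]; tauto)
  have hax : a ∉ used c x := by rw [← hdx, hSx]; tauto
  have hv3 := hc.card_compl_used (z := v) (n := 3) (by omega)
  obtain ⟨α, hα, hαb⟩ := Finset.exists_mem_ne (by omega) b (s := (used c v)ᶜ)
  rw [Finset.mem_compl] at hα
  refine hno c hc ⟨α, b, a, hα, hbw, hax, hαb, ?_, hab.symm, fun h => ?_, fun h => ?_,
    fun h => ?_⟩
  · rintro rfl; exact hα hav
  · exact (mem_used_of_reachable hvw h).elim hα hbv
  -- The `α`/`a` path from `v` already ends at `w`, so it cannot also reach `x`.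
  · exact hc.not_reachable (.inl hα) (.inr ha) (.inr hax) hvw hvx hwx (hconf α hα hαb) h
  · exact (mem_used_of_reachable hwx h).elim hbw ha

/-- A coloring that extends to a common neighbor of `w` and `x` can be changed such that it
extends to a common neighbor of `v`, `w` and `x` if `v` has degree at most two. -/
theorem IsAcyclicPartial.exists_starExtendable (hc : IsAcyclicPartial G c) {v w x : V}
    (hD : Fintype.card C = D + 2) (hdeg : ∀ z, (G.neighborSet z).ncard ≤ D)
    (hv : (G.neighborSet v).ncard ≤ 2) (hv' : (G.neighborSet v).ncard + 1 ≤ D)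
    (hw : (G.neighborSet w).ncard + 1 ≤ D)
    (hx : (G.neighborSet x).ncard + 1 ≤ D) (hvw : v ≠ w) (hvx : v ≠ x) (hwx : w ≠ x)
    {a b : C} (ha : a ∉ used c w) (hb : b ∉ used c x)
    (hab : a ≠ b) (h : ¬ (twoColor c a b).Reachable w x) :
    ∃ c : Sym2 V → Option C, IsAcyclicPartial G c ∧ StarExtendable c v w x := by
  by_contra! hno
  have hno' : ∀ c : Sym2 V → Option C, IsAcyclicPartial G c → ¬ StarExtendable c v x w :=
    fun c hc h => hno c hc h.swap_right
  have h' : ¬ (twoColor c b a).Reachable x w := fun e => h (by rw [twoColor_comm]; exact e.symm)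
  have hv3 := hc.card_compl_used (z := v) (n := 3) (by omega)
  have hw3 := hc.card_compl_used (z := w) (n := 3) (by omega)
  have hcard2 : ({a, b} : Finset C).card ≤ 2 := Finset.card_le_two
  by_cases hav : a ∈ used c v <;> by_cases hbv : b ∈ used c v
  · have hv2 : used c v = {a, b} := by
      refine (Finset.eq_of_subset_of_card_le ?_ ?_).symm
      · simp [Finset.insert_subset_iff, hav, hbv]
      · rw [Finset.card_pair hab]
        exact (hc.card_used_le v).trans hv
    obtain ⟨γ, hγ, hγab⟩ := Finset.exists_mem_notMem_of_card_lt_card (s := {a, b})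
      (t := (used c w)ᶜ) (by omega)
    rw [Finset.mem_compl] at hγ
    have hγv : γ ∉ used c v := hv2 ▸ hγab
    simp only [Finset.mem_insert, Finset.mem_singleton, not_or] at hγab
    -- If a `γ`/`b` path joins `w` and `x`, it cannot reach `v`, so `γ` is safe at `v`. If not, `γ`
    -- replaces `a` at `w`, and `b` is then the only chosen color seen at `v`.
    by_cases hr : (twoColor c γ b).Reachable w x
    · refine hno c hc ⟨γ, a, b, hγv, ha, hb, hγab.1, hγab.2, hab, fun e => ?_, fun e => ?_, h⟩
      · exact (mem_used_of_reachable hvw.symm e.symm).elim hγ ha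
      · exact hc.not_reachable (.inr hb) (.inl hγ) (.inl hγv) hwx.symm hvx.symm hvw.symm
          hr.symm e.symm
    · exact hc.false_of_one_common hD hdeg hv hv' hx hw hvx hvw hwx.symm hno' hb hγ
        (Ne.symm hγab.2) (fun e => hr (by rw [twoColor_comm]; exact e.symm)) hbv hγv
  · exact hc.false_of_one_common hD hdeg hv hv' hw hx hvw hvx hwx hno ha hb hab h hav hbv
  · exact hc.false_of_one_common hD hdeg hv hv' hx hw hvx hvw hwx.symm hno' hb ha hab.symm
      h' hbv hav
  · obtain ⟨α, hα, hαab⟩ := Finset.exists_mem_notMem_of_card_lt_card (s := {a, b})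
      (t := (used c v)ᶜ) (by omega)
    rw [Finset.mem_compl] at hα
    simp only [Finset.mem_insert, Finset.mem_singleton, not_or] at hαab
    refine hno c hc ⟨α, a, b, hα, ha, hb, hαab.1, hαab.2, hab, fun e => ?_, fun e => ?_, h⟩
    · exact (mem_used_of_reachable hvw e).elim hα hav
    · exact (mem_used_of_reachable hvx e).elim hα hbv

end SmallNeighbor

/-! ### The induction -/

section Induction

open Function

variable {V C : Type*} [Fintype C] {G : SimpleGraph V} {c : Sym2 V → Option C}

/-- The colors of `uw` and `ux` serve as `a` and `b`: a path in these colors from `w` to `x` would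
close to a bichromatic cycle through `u`. -/
theorem IsAcyclicPartial.exists_of_cherry [DecidableEq V] {u w x : V} (hu : ∀ y, ¬ G.Adj u y)
    (huw : u ≠ w) (hux : u ≠ x) (hwx : w ≠ x)
    (hc : IsAcyclicPartial (G ⊔ edge u w ⊔ edge u x) c) :
    ∃ (c' : Sym2 V → Option C) (a b : C), IsAcyclicPartial G c' ∧ a ∉ used c' w ∧
      b ∉ used c' x ∧ a ≠ b ∧ ¬ (twoColor c' a b).Reachable w x := by
  have hu' : ∀ y, ¬ G.Adj y u := fun y h => hu y h.symm
  obtain ⟨a, ha⟩ := Option.ne_none_iff_exists'.1 ((hc.adj_iff u w).1 (by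
    rw [sup_adj, sup_adj, edge_adj]
    exact .inl (.inr ⟨.inl ⟨rfl, rfl⟩, huw⟩)))
  obtain ⟨b, hb⟩ := Option.ne_none_iff_exists'.1 ((hc.adj_iff u x).1 (by
    rw [sup_adj, edge_adj]
    exact .inr ⟨.inl ⟨rfl, rfl⟩, hux⟩))
  have hb' : update c s(u, w) none s(u, x) = some b := by
    rw [update_of_ne _, hb]
    simp only [ne_eq, Sym2.eq_iff]
    grind
  have hd := hc.erase u w
  have hd' := hd.erase u x
  refine ⟨update (update c s(u, w) none) s(u, x) none, a, b, ?_, ?_, ?_, ?_, fun h => ?_⟩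
  · convert hd' using 1
    ext y z
    simp only [deleteEdges_adj, sup_adj, edge_adj, Set.mem_singleton_iff, Sym2.eq_iff]
    grind
  · rw [used_update_of_ne huw.symm hwx, hc.mem_used_update_none_right ha]
    tauto
  · rw [hd.mem_used_update_none_right hb']
    tauto
  · rintro rfl
    exact hwx (hc.proper _ _ _ _ ha hb)
  · have h1 : (twoColor (update c s(u, w) none) a b).Reachable u w :=
      (Adj.reachable (G := twoColor _ a b) ⟨hux, .inr hb'⟩).trans (h.symm.mono fun y z h => by
        simp only [twoColor, update_apply] at h ⊢
        grind)
    have h2 : (twoColor (update c s(u, w) none) a b ⊔ edge u w).IsAcyclic := by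
      refine (hc.acyclic a b).anti fun y z h => ?_
      rw [sup_adj, edge_adj] at h
      simp only [twoColor, update_apply, Sym2.eq_iff] at h ⊢
      grind [Sym2.eq_swap]
    rcases (isAcyclic_sup_fromEdgeSet_iff.1 h2).2 h1 with h | ⟨-, h⟩
    · exact huw h
    · simp at h

variable [Finite V] {D : ℕ}

theorem ncard_neighborSet_mono {H : SimpleGraph V} (h : H ≤ G) (z : V) :
    (H.neighborSet z).ncard ≤ (G.neighborSet z).ncard :=
  Set.ncard_le_ncard (fun _ hy => h hy) (Set.toFinite _)

theorem ncard_neighborSet_deleteIncidenceSet {u z : V} (h : G.Adj u z) :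
    ((G.deleteIncidenceSet u).neighborSet z).ncard + 1 ≤ (G.neighborSet z).ncard := by
  refine Set.ncard_lt_ncard ⟨fun y hy => G.deleteIncidenceSet_le u hy, fun hs => ?_⟩
    (Set.toFinite _)
  exact (deleteIncidenceSet_adj.1 (hs h.symm)).2.2 rfl

/-- A neighbor of degree at least four of a deleted vertex is a hub. -/
theorem isHub_deleteIncidenceSet (hD : Fintype.card C = D + 2)
    (hdeg : ∀ z, (G.neighborSet z).ncard ≤ D)
    (hsp : ∀ y z, G.Adj y z → (G.neighborSet y).ncard ≤ 3 ∨ (G.neighborSet z).ncard ≤ 3)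
    {u z : V} (h : G.Adj u z) (hz : 3 < (G.neighborSet z).ncard) :
    IsHub (G.deleteIncidenceSet u) C z where
  degree_le := by
    have := ncard_neighborSet_deleteIncidenceSet h
    have := hdeg z
    omega
  neighbor_degree_le y hy := by
    have := hsp z y (G.deleteIncidenceSet_le u hy)
    have := ncard_neighborSet_mono (G.deleteIncidenceSet_le u) y
    omega

/-- Three-sparse graphs of maximum degree `D` have acyclic edge colorings with `D + 2` colors. -/
theorem exists_isAcyclicPartial (hD : Fintype.card C = D + 2) (G : SimpleGraph V)
    (hdeg : ∀ z, (G.neighborSet z).ncard ≤ D)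
    (hsp : ∀ y z, G.Adj y z → (G.neighborSet y).ncard ≤ 3 ∨ (G.neighborSet z).ncard ≤ 3) :
    ∃ c : Sym2 V → Option C, IsAcyclicPartial G c := by
  classical
  induction G using WellFoundedLT.induction with
  | ind G ih =>
  have ih' : ∀ H < G, ∃ c : Sym2 V → Option C, IsAcyclicPartial H c := by
    intro H hH
    have hmono := ncard_neighborSet_mono hH.le
    refine ih H hH (fun z => (hmono z).trans (hdeg z)) fun y z h => ?_
    exact (hsp y z (hH.le h)).imp (hmono y).trans (hmono z).trans
  by_cases hbot : ∀ x y, ¬ G.Adj x y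
  · refine ⟨fun _ => none, fun x y => by simp [hbot], by simp, fun a b => ?_⟩
    convert isAcyclic_bot
    ext
    simp [twoColor]
  push Not at hbot
  -- Take an edge between two vertices of degree at most three if there is one; otherwise every
  -- neighbor of a vertex of degree at most three has larger degree.
  obtain ⟨u, v, huv, hu3, hv⟩ : ∃ u v, G.Adj u v ∧ (G.neighborSet u).ncard ≤ 3 ∧
      ((G.neighborSet v).ncard ≤ 3 ∨ ∀ z, G.Adj u z → 3 < (G.neighborSet z).ncard) := by
    by_cases h : ∃ u v, G.Adj u v ∧ (G.neighborSet u).ncard ≤ 3 ∧ (G.neighborSet v).ncard ≤ 3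
    · obtain ⟨u, v, h1, h2, h3⟩ := h
      exact ⟨u, v, h1, h2, .inl h3⟩
    · push Not at h
      obtain ⟨u, v, huv⟩ := hbot
      rcases hsp u v huv with hu | hv
      · exact ⟨u, v, huv, hu, .inr fun z hz => h u z hz hu⟩
      · exact ⟨v, u, huv.symm, hv, .inr fun z hz => h v z hz hv⟩
  set G₀ := G.deleteIncidenceSet u
  have hle : G₀ ≤ G := G.deleteIncidenceSet_le u
  have hadj : ∀ y z, G₀.Adj y z ↔ G.Adj y z ∧ y ≠ u ∧ z ≠ u := fun y z => deleteIncidenceSet_adj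
  have hiso : ∀ y, ¬ G₀.Adj u y := fun y h => ((hadj u y).1 h).2.1 rfl
  have hdec : ∀ z, G.Adj u z → (G₀.neighborSet z).ncard + 1 ≤ D := fun z hz =>
    (ncard_neighborSet_deleteIncidenceSet hz).trans (hdeg z)
  have hlist : ∀ z, G.Adj u z → (G₀.neighborSet z).ncard + 3 ≤ Fintype.card C := fun z hz => by
    have := hdec z hz
    omega
  have hhub : ∀ z, G.Adj u z → 3 < (G.neighborSet z).ncard → IsHub G₀ C z := fun z =>
    isHub_deleteIncidenceSet hD hdeg hsp
  obtain ⟨c, hc⟩ := ih' G₀ (lt_of_le_of_ne hle fun e => hiso v (e ▸ huv))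
  have hcu := hc.used_eq_empty hiso
  have hvsmall : (G.neighborSet v).ncard ≤ 3 → (G₀.neighborSet v).ncard ≤ 2 := fun h => by
    have : (G₀.neighborSet v).ncard + 1 ≤ _ := ncard_neighborSet_deleteIncidenceSet huv
    omega
  have hcard : (G.neighborSet u \ {v}).ncard ≤ 2 := by
    have := Set.ncard_sdiff_singleton_add_one (s := G.neighborSet u) huv (Set.toFinite _)
    omega
  have hN : ∀ y, G.Adj u y ↔ y = v ∨ y ∈ G.neighborSet u \ {v} := by
    intro y
    simp only [Set.mem_sdiff, mem_neighborSet, Set.mem_singleton_iff]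
    by_cases h : y = v
    · simp [h, huv]
    · simp [h]
  interval_cases hn : (G.neighborSet u \ {v}).ncard
  · rw [Set.ncard_eq_zero] at hn
    simp only [hn, Set.mem_empty_iff_false, or_false] at hN
    obtain ⟨α, hα⟩ := Finset.card_pos.1
      (lt_of_lt_of_le (by omega : 0 < 3) (hc.card_compl_used (hlist v huv)))
    have h := hc.add_pendant hcu huv.ne (Finset.mem_compl.1 hα)
    have hG : G = G₀ ⊔ edge u v := by
      ext y z
      rw [sup_adj, edge_adj, hadj]
      grind [SimpleGraph.adj_comm, SimpleGraph.Adj.ne]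
    exact ⟨_, hG ▸ h⟩
  · obtain ⟨w, hw⟩ := Set.ncard_eq_one.1 hn
    simp only [hw, Set.mem_singleton_iff] at hN
    have huw : G.Adj u w := (hN w).2 (.inr rfl)
    have hvw : v ≠ w := fun e =>
      (hw.symm ▸ Set.mem_singleton w : w ∈ G.neighborSet u \ {v}).2 e.symm
    obtain ⟨α, β, hα, hβ, hαβ, hr⟩ := hc.exists_cherry hvw (hlist v huv) (hlist w huw)
      (hv.symm.imp (fun h => hhub v huv (h v huv)) hvsmall)
    have h := hc.add_cherry hcu huv.ne huw.ne hvw hα hβ hαβ hr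
    have hG : G = G₀ ⊔ edge u v ⊔ edge u w := by
      ext y z
      rw [sup_adj, sup_adj, edge_adj, edge_adj, hadj]
      grind [SimpleGraph.adj_comm, SimpleGraph.Adj.ne]
    exact ⟨_, hG ▸ h⟩
  · obtain ⟨w, x, hwx, hw⟩ := Set.ncard_eq_two.1 hn
    have hvw : v ≠ w := fun e =>
      (hw.symm ▸ Set.mem_insert w {x} : w ∈ G.neighborSet u \ {v}).2 e.symm
    have hvx : v ≠ x := fun e =>
      (hw.symm ▸ Set.mem_insert_of_mem w rfl : x ∈ G.neighborSet u \ {v}).2 e.symm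
    simp only [hw, Set.mem_insert_iff, Set.mem_singleton_iff] at hN
    have huw : G.Adj u w := (hN w).2 (.inr (.inl rfl))
    have hux : G.Adj u x := (hN x).2 (.inr (.inr rfl))
    have hG : G = G₀ ⊔ edge u v ⊔ edge u w ⊔ edge u x := by
      ext y z
      rw [sup_adj, sup_adj, sup_adj, edge_adj, edge_adj, edge_adj, hadj]
      grind [SimpleGraph.adj_comm, SimpleGraph.Adj.ne]
    suffices ∃ c : Sym2 V → Option C, IsAcyclicPartial G₀ c ∧ StarExtendable c v w x by
      obtain ⟨d, hd, hext⟩ := this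
      obtain ⟨d', hd'⟩ := hd.exists_of_starExtendable (hd.used_eq_empty hiso) huv.ne huw.ne
        hux.ne hvw hvx hwx hext
      exact ⟨d', hG ▸ hd'⟩
    rcases hv with hv | hv
    -- The coloring `c` of `G₀` is dropped here: only one that comes from `G` without `uv` supplies
    -- compatible colors at `w` and `x`.
    · have hlt : G₀ ⊔ edge u w ⊔ edge u x < G := by
        refine lt_of_le_of_ne ?_ fun e => ?_
        · conv_rhs => rw [hG]
          exact sup_le_sup_right (sup_le_sup_right le_sup_left _) _
        · have := e.symm ▸ huv
          rw [sup_adj, sup_adj, edge_adj, edge_adj] at this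
          grind
      obtain ⟨d, hd⟩ := ih' _ hlt
      obtain ⟨d', a, b, hd', ha, hb, hab, hr⟩ := hd.exists_of_cherry hiso huw.ne hux.ne hwx
      exact hd'.exists_starExtendable hD
        (fun z => (ncard_neighborSet_mono hle z).trans (hdeg z)) (hvsmall hv) (hdec v huv)
        (hdec w huw) (hdec x hux) hvw hvx hwx ha hb hab hr
    · have hnadj : ∀ y z, G.Adj u y → G.Adj u z → ¬ G₀.Adj y z := by
        intro y z hy hz h
        have h1 := hsp y z (hle h)
        have h2 := hv y hy
        have h3 := hv z hz
        omega
      exact IsHubTriple.exists_starExtendable ⟨hhub v huv (hv v huv), hhub w huw (hv w huw),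
        hhub x hux (hv x hux), hvw, hvx, hwx, hnadj _ _ huv huw, hnadj _ _ huv hux,
        hnadj _ _ huw hux⟩ hc

end Induction

/-! ### From partial colorings to colorings of the line graph -/

theorem IsAcyclicPartial.acyclicEdgeColorable {V : Type*} {G : SimpleGraph V} {k : ℕ}
    {c : Sym2 V → Option (Fin k)} (hc : IsAcyclicPartial G c) : G.AcyclicEdgeColorable k := by
  have h : ∀ e : G.edgeSet, ∃ a, c e = some a := by
    rintro ⟨e, he⟩
    induction e using Sym2.ind with
    | _ x y => exact Option.ne_none_iff_exists'.1 ((hc.adj_iff x y).1 he)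
  choose f hf using h
  refine ⟨Coloring.mk f ?_, ?_⟩
  · intro e₁ e₂ h he
    obtain ⟨hne, v, h₁, h₂⟩ := lineGraph_adj_iff_exists.1 h
    obtain ⟨y, hy⟩ := Sym2.mem_iff_exists.1 h₁
    obtain ⟨z, hz⟩ := Sym2.mem_iff_exists.1 h₂
    have h3 := hf e₁
    have h4 := hf e₂
    rw [he, hy] at h3
    rw [hz] at h4
    exact hne (Subtype.ext (by rw [hy, hz, hc.proper _ _ _ _ h3 h4]))
  · intro v w hw hb
    obtain ⟨a, b, -, hab⟩ := Set.ncard_eq_two.1 hb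
    -- A bichromatic cycle would lie entirely in the forest `twoColor c a b`.
    have hmem : ∀ e ∈ w.edges, e ∈ (twoColor c a b).edgeSet := by
      intro e he
      have heG := w.edges_subset_edgeSet he
      have h1 : f ⟨e, heG⟩ ∈ ({a, b} : Set (Fin k)) := hab ▸ ⟨⟨e, heG⟩, he, rfl⟩
      have h2 := hf ⟨e, heG⟩
      induction e using Sym2.ind with
      | _ x y =>
        refine ⟨Adj.ne heG, ?_⟩
        rw [h2]
        rcases h1 with h1 | h1
        · exact .inl (congrArg some h1)
        · exact .inr (congrArg some h1)
    exact hc.acyclic a b _ (hw.transfer hmem)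

end SimpleGraph

theorem corollary2 {V : Type*} [Fintype V] (G : SimpleGraph V) [DecidableRel G.Adj]
    (hG : G.IsSparse 3) :
    G.acyclicChromaticIndex ≤ (G.maxDegree : ℕ∞) + 2 := by
  have hdeg : ∀ z, (G.neighborSet z).ncard = G.degree z := fun z => by
    rw [Set.ncard_eq_toFinset_card', Set.toFinset_card, G.card_neighborSet_eq_degree]
  obtain ⟨c, hc⟩ := SimpleGraph.exists_isAcyclicPartial (C := Fin (G.maxDegree + 2))
    (D := G.maxDegree) (by simp) G (fun z => (hdeg z).trans_le (G.degree_le_maxDegree z))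
    (fun y z h => by rw [hdeg, hdeg]; exact hG h)
  exact (iInf₂_le _ hc.acyclicEdgeColorable).trans (by simp)
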